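/- **General regret bound for Thompson sampling.** Let $\mathcal A$ (actions), $\mathcal Y$ (observations) and $\Theta$ (parameters) be finite sets. For $a\in\mathcal A$, $\theta\in\Theta$ let $l(\cdot;a,\theta)$ be a probability distribution on $\mathcal Y$, the law of the observation when $a$ is played under parameter $\theta$, and assume that there is $\Gamma\in(0,1/2)$ with $\Gamma\le l(y;a,\theta)\le 1-\Gamma$ for all $y,a,\theta$. Let $\hat h:\mathcal Y\to\mathbb R$ be a reward function, let $\pi$ be a prior distribution on $\Theta$, and for each $\theta$ let $a^*(\theta)$ be an action maximizing $a\mapsto\sum_y l(y;a,\theta)\hat h(y)$ (ties broken arbitrarily). Let $\theta^*\in\Theta$ be the true parameter, with $\pi(\theta^*)>0$, and assume that $a^*:=a^*(\theta^*)$ is the unique maximizer for $\theta=\theta^*$. Thompson sampling starts from $\pi_0=\pi$ and in round $t=1,2,\dots$ draws $\theta_t\sim\pi_{t-1}$, plays $A_t=a^*(\theta_t)$, observes $Y_t\sim l(\cdot;A_t,\theta^*)$, and sets $\pi_t(\theta)\propto l(Y_t;A_t,\theta)\,\pi_{t-1}(\theta)$. Let $N_T(a)=\#\{t\le T: A_t=a\}$.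 Write $D_\theta(a)=D(\theta^*_a\|\theta_a)$ for the Kullback–Leibler divergence of $l(\cdot;a,\theta)$ from $l(\cdot;a,\theta^*)$, that is $\sum_y l(y;a,\theta^*)\log\frac{l(y;a,\theta^*)}{l(y;a,\theta)}$, and for $a\ne a^*$ let $S_a'=\{\theta\in\Theta: a^*(\theta)=a,\ D_\theta(a^*)=0\}$. Let $e^{(j)}$ be the unit vector of coordinate $j$ in $\mathbb R^{\mathcal A}$ and put $n=|\mathcal A|-1$. Then for all $\delta,\epsilon\in(0,1)$ there is a constant $\mathsf B$, depending on $\delta,\epsilon,\mathcal A,\mathcal Y,\Theta,\pi$ (and on $l$, $\hat h$, $a^*(\cdot)$) but not on $T$, and there is $T^\star\ge 0$, such that for all integers $T\ge T^\star$, with probability at least $1-\delta$, $$\sum_{a\ne a^*}N_T(a)\ \le\ \mathsf B+\mathsf C(\log T),$$ where, with $L=\frac{1+\epsilon}{1-\epsilon}\log T$, $\mathsf C(\log T)$ is the maximum (which is attained) of $$\sum_{k=1}^{n} z_k(a_k)$$ over all enumerations $a_1,\dots,a_n$ of $\mathcal A\setminus\{a^*\}$ without repetition and all $z_1,\dots,z_n\in\mathbb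 Z_{\ge0}^{\mathcal A}$ with $z_k(a^*)=0$ such that 1. $z_i(a)\ge z_k(a)$ for all $a$, and $z_i(a_k)=z_k(a_k)$, whenever $i\ge k$; 2. for every $k$ with $S'_{a_k}\neq\emptyset$: $\ \min_{\theta\in S'_{a_k}}\langle z_k,D_\theta\rangle\ge L$, and $\min_{\theta\in S'_{a_k}}\langle z_k-e^{(j)},D_\theta\rangle<L$ for some $j\in\mathcal A\setminus\{a^*\}$; 3. for every $k$ with $S'_{a_k}=\emptyset$: $\ z_k(a_k)=0$. -/

import Mathlib

open scoped ENNReal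

/-- A stochastic bandit with finitely many observations: `lik a θ` is the distribution of the
observation after playing `a` under parameter `θ`, `reward` is the reward attached to an
observation, `prior` is the fictitious prior, and `opt θ` is the chosen maximizer of the expected
reward under `θ` (ties between maximizers may be broken in any way). -/
structure BanditModel (A Θ Y : Type*) [Fintype Y] where
  lik : A → Θ → PMF Y
  reward : Y → ℝ
  prior : PMF Θ
  opt : Θ → A
  opt_isMax : ∀ (θ : Θ) (a : A),
    ∑ y, (lik a θ y).toReal * reward y ≤ ∑ y, (lik (opt θ) θ y).toReal * reward y

/-- Bayes update of `p` by the likelihood function `w`: proportional to `w θ * p θ`.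
The `else` branch only serves likelihood functions that cannot be normalized; it never occurs when
all likelihoods are positive. -/
noncomputable def bayesUpdate {Θ : Type*} (p : PMF Θ) (w : Θ → ℝ≥0∞) : PMF Θ :=
  open Classical in
  if hw : (∑' θ, w θ * p θ) ≠ 0 ∧ (∑' θ, w θ * p θ) ≠ ∞ then
    PMF.normalize (fun θ => w θ * p θ) hw.1 hw.2
  else p

/-- Kullback-Leibler divergence (natural logarithm) of two distributions on a finite set, as a
real number. -/
noncomputable def klReal {Y : Type*} (p q : PMF Y) : ℝ :=
  letI : MeasurableSpace Y := ⊤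
  (InformationTheory.klDiv p.toMeasure q.toMeasure).toReal

namespace BanditModel

variable {A Θ Y : Type*} [Fintype Y]

/-- Expected reward of action `a` under parameter `θ`. -/
noncomputable def meanReward (M : BanditModel A Θ Y) (a : A) (θ : Θ) : ℝ :=
  ∑ y, (M.lik a θ y).toReal * M.reward y

/-- The posterior after a history. A history lists the rounds played so far, the latest first; a
round is the pair (sampled parameter `ϑ`, observation `y`), the action played in it being
`M.opt ϑ`. -/
noncomputable def posterior (M : BanditModel A Θ Y) : List (Θ × Y) → PMF Θ
  | [] => M.prior
  | (ϑ, y) :: h => bayesUpdate (M.posterior h) (fun θ => M.lik (M.opt ϑ) θ y)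

/-- Law of the first `t` rounds of Thompson sampling when the true parameter is `θs`: in each round
a parameter `ϑ` is drawn from the current posterior, the action `M.opt ϑ` is played, and an
observation is drawn from `M.lik (M.opt ϑ) θs`. -/
noncomputable def tsLaw (M : BanditModel A Θ Y) (θs : Θ) : ℕ → PMF (List (Θ × Y))
  | 0 => PMF.pure []
  | t + 1 => (M.tsLaw θs t).bind fun h =>
      (M.posterior h).bind fun ϑ =>
        (M.lik (M.opt ϑ) θs).map fun y => (ϑ, y) :: h

/-- Number of plays of action `a` in a history. -/
def playCount [DecidableEq A] (M : BanditModel A Θ Y) (h : List (Θ × Y)) (a : A) : ℕ :=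
  h.countP fun e => decide (M.opt e.1 = a)

/-- Marginal divergence `D(θs_a ‖ θ_a)`. -/
noncomputable def div (M : BanditModel A Θ Y) (θs θ : Θ) (a : A) : ℝ :=
  klReal (M.lik a θs) (M.lik a θ)

/-- `S'_a`: the parameters whose optimal action is `a` and whose observation distribution under the
action `M.opt θs` agrees with that of `θs`. -/
def exactMatch (M : BanditModel A Θ Y) (θs : Θ) (a : A) : Set Θ :=
  {θ | M.opt θ = a ∧ M.div θs θ (M.opt θs) = 0}

/-- Feasibility of a path `z` with elimination order `act` at threshold `L`. A minimum over the
finite set `S'_a ≠ ∅` is at least `L` iff all its terms are, and below `L` iff some term is. -/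
structure IsPath [Fintype A] [DecidableEq A] (M : BanditModel A Θ Y) (θs : Θ) (L : ℝ)
    (z : Fin (Fintype.card A - 1) → A → ℕ) (act : Fin (Fintype.card A - 1) → A) : Prop where
  z_opt : ∀ k, z k (M.opt θs) = 0
  act_ne : ∀ k, act k ≠ M.opt θs
  act_injective : Function.Injective act
  mono : ∀ k i, k ≤ i → z k ≤ z i
  frozen : ∀ k i, k ≤ i → z i (act k) = z k (act k)
  reached : ∀ k, ∀ θ ∈ M.exactMatch θs (act k), L ≤ ∑ a, (z k a : ℝ) * M.div θs θ a
  just_reached : ∀ k, (M.exactMatch θs (act k)).Nonempty →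
    ∃ j, j ≠ M.opt θs ∧ ∃ θ ∈ M.exactMatch θs (act k),
      ∑ a, ((z k a : ℝ) - if a = j then 1 else 0) * M.div θs θ a < L
  of_empty : ∀ k, M.exactMatch θs (act k) = ∅ → z k (act k) = 0

/-- The objective values `∑ₖ zₖ(aₖ)` of the feasible paths at threshold `L`. -/
def pathValues [Fintype A] [DecidableEq A] (M : BanditModel A Θ Y) (θs : Θ) (L : ℝ) : Set ℕ :=
  {v | ∃ z act, M.IsPath θs L z act ∧ v = ∑ k, z k (act k)}

end BanditModel

/-! Apart from three events of small probability, every suboptimal play is charged either to a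
bounded budget or to a feasible path.

Good histories: under the true parameter, the inverse of its posterior weight is a martingale, and
for small `x > 0` the exponential of `x` times each score is a supermartingale. By Ville's
inequality the true weight stays above a constant `p` and all scores stay below a constant `s`, at
all times at once. The posterior of `θ` is then at most a constant times `exp (-(1 - ε) *
totalDiv)`.

Late plays: sampling `θ` after its total divergence has reached `L` has conditional probability of
order `T ^ (-(1 + ε))`, so this is unlikely to happen in any of the `T` rounds.

Misfits: a parameter that disagrees with `θs` on the optimal action has posterior exponentially
small in the number of plays of that action, and each round plays it with probability at least `p`.
A Lyapunov function bounds the expected number of misfits uniformly in `T`; this gives the additive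
constant.

Every other suboptimal play uses an action `a` through some `θ ∈ S'_a` whose total divergence is
still below `L`. Such plays form a run of active actions. Continued until no action is active and
read at the elimination times, the run becomes a feasible path of at least the same value
(`Reachable.exists_pathValue_ge`). -/

/-! ### Kullback–Leibler divergence on a finite set. -/

section KullbackLeibler

theorem klReal_nonneg {Y : Type*} (p q : PMF Y) : 0 ≤ klReal p q := ENNReal.toReal_nonneg

variable {Y : Type*} [Fintype Y]

theorem PMF.sum_toReal (p : PMF Y) : ∑ y, (p y).toReal = 1 := by
  rw [← ENNReal.toReal_sum fun y _ => p.apply_ne_top y, ← tsum_fintype (L := .unconditional _),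
    p.tsum_coe, ENNReal.toReal_one]

theorem klReal_eq_sum (p q : PMF Y) (hp : ∀ y, 0 < (p y).toReal) (hq : ∀ y, 0 < (q y).toReal) :
    klReal p q = ∑ y, (p y).toReal * (Real.log (p y).toReal - Real.log (q y).toReal) := by
  let _ : MeasurableSpace Y := ⊤
  have hq0 : ∀ y, q y ≠ 0 := fun y h => by simpa [h] using hq y
  have hms : ∀ s : Set Y, MeasurableSet s := fun _ => trivial
  have hac : p.toMeasure.AbsolutelyContinuous q.toMeasure := by
    intro s hs
    rw [PMF.toMeasure_apply_eq_zero_iff _ (hms s)] at hs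
    have : s = ∅ := by
      ext y
      simp only [Set.mem_empty_iff_false, iff_false]
      intro hy
      exact Set.disjoint_left.1 hs ((q.mem_support_iff y).2 (hq0 y)) hy
    simp [this]
  have hrn : ∀ y, p.toMeasure.rnDeriv q.toMeasure y = p y / q y := by
    intro y
    have h := MeasureTheory.Measure.setLIntegral_rnDeriv hac {y}
    rw [MeasureTheory.lintegral_singleton, PMF.toMeasure_apply_singleton _ _ (hms _),
      PMF.toMeasure_apply_singleton _ _ (hms _)] at h
    rw [← h, ENNReal.mul_div_cancel_right (hq0 y) (q.apply_ne_top y)]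
  change (InformationTheory.klDiv p.toMeasure q.toMeasure).toReal = _
  rw [InformationTheory.toReal_klDiv_of_measure_eq hac (by simp), PMF.integral_eq_sum]
  refine Finset.sum_congr rfl fun y _ => ?_
  rw [MeasureTheory.llr, hrn, ENNReal.toReal_div, Real.log_div (hp y).ne' (hq y).ne', smul_eq_mul]

/-- Equality case of Gibbs' inequality: subtracting `p y - q y`, which sums to zero, makes every
summand nonnegative by `log x ≤ x - 1`, and strictly positive unless `q y / p y = 1`. -/
theorem eq_of_klReal_eq_zero (p q : PMF Y) (hp : ∀ y, 0 < (p y).toReal)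
    (hq : ∀ y, 0 < (q y).toReal) (h : klReal p q = 0) : p = q := by
  have hterm : ∀ y ∈ Finset.univ, 0 ≤ (p y).toReal *
      (Real.log (p y).toReal - Real.log (q y).toReal) - ((p y).toReal - (q y).toReal) := by
    intro y _
    have h1 := Real.log_le_sub_one_of_pos (div_pos (hq y) (hp y))
    rw [Real.log_div (hq y).ne' (hp y).ne'] at h1
    have h2 := mul_le_mul_of_nonneg_left h1 (hp y).le
    rw [mul_sub (p y).toReal (_ / _), mul_div_cancel₀ _ (hp y).ne'] at h2
    linarith
  have hsum : ∑ y, ((p y).toReal * (Real.log (p y).toReal - Real.log (q y).toReal) -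
      ((p y).toReal - (q y).toReal)) = 0 := by
    rw [Finset.sum_sub_distrib, ← klReal_eq_sum p q hp hq, Finset.sum_sub_distrib, h,
      p.sum_toReal, q.sum_toReal]
    ring
  rw [Finset.sum_eq_zero_iff_of_nonneg hterm] at hsum
  ext y
  by_contra hne
  have hne' : (q y).toReal / (p y).toReal ≠ 1 := by
    intro h1
    rw [div_eq_one_iff_eq (hp y).ne'] at h1
    exact hne ((ENNReal.toReal_eq_toReal_iff' (p.apply_ne_top y) (q.apply_ne_top y)).1 h1.symm)
  have h1 := Real.log_lt_sub_one_of_pos (div_pos (hq y) (hp y)) hne'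
  rw [Real.log_div (hq y).ne' (hp y).ne'] at h1
  have h2 := mul_lt_mul_of_pos_left h1 (hp y)
  rw [mul_sub (p y).toReal (_ / _), mul_div_cancel₀ _ (hp y).ne'] at h2
  have := hsum y (Finset.mem_univ y)
  linarith

/-- For small `x`, the exponential moment of order `x` of the log-likelihood ratio, recentered by a
proportion `1 - ε` of its mean, is at most one. -/
theorem eventually_sum_exp_le_one (p q : PMF Y) (hp : ∀ y, 0 < (p y).toReal)
    (hq : ∀ y, 0 < (q y).toReal) {ε : ℝ} (hε : 0 < ε) :
    ∀ᶠ x : ℝ in nhdsWithin 0 (Set.Ioi 0), ∑ y, (p y).toReal * Real.exp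
      (x * (Real.log (q y).toReal - Real.log (p y).toReal + (1 - ε) * klReal p q)) ≤ 1 := by
  rcases (klReal_nonneg p q).eq_or_lt with h0 | hD
  · obtain rfl := eq_of_klReal_eq_zero p q hp hq h0.symm
    simp [← h0, p.sum_toReal]
  set u : Y → ℝ := fun y =>
    Real.log (q y).toReal - Real.log (p y).toReal + (1 - ε) * klReal p q with hu
  let φ : ℝ → ℝ := fun x => ∑ y, (p y).toReal * Real.exp (x * u y)
  have hmean : ∑ y, (p y).toReal * u y = - (ε * klReal p q) := by
    have : ∑ y, (p y).toReal * u y = - klReal p q + ∑ y, (p y).toReal * ((1 - ε) * klReal p q) := by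
      rw [klReal_eq_sum p q hp hq, ← Finset.sum_neg_distrib, ← Finset.sum_add_distrib]
      refine Finset.sum_congr rfl fun y _ => ?_
      simp only [hu]
      rw [klReal_eq_sum p q hp hq]
      ring
    rw [this, ← Finset.sum_mul, p.sum_toReal]
    ring
  -- `φ 0 = 1` and the slope at zero is negative, so `φ` drops below one just to the right of zero.
  have hderiv : HasDerivAt φ (- (ε * klReal p q)) 0 := by
    rw [← hmean]
    refine HasDerivAt.fun_sum fun y _ => ?_
    have h1 : HasDerivAt (fun x : ℝ => x * u y) (u y) 0 := by
      simpa using (hasDerivAt_id (0 : ℝ)).mul_const (u y)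
    simpa using h1.exp.const_mul (p y).toReal
  have hlt : ∀ᶠ x in nhdsWithin 0 (Set.Ioi (0 : ℝ)), slope φ 0 x < 0 :=
    ((hasDerivAt_iff_tendsto_slope.1 hderiv).mono_left
      (nhdsWithin_mono _ fun x hx => (ne_of_gt hx : x ≠ 0))).eventually
        (gt_mem_nhds (by simpa using mul_pos hε hD))
  filter_upwards [hlt, self_mem_nhdsWithin] with x hx hx0
  have hx0 : 0 < x := hx0
  have hφ0 : φ 0 = 1 := by simp [φ, p.sum_toReal]
  rw [slope_def_field, sub_zero, div_lt_iff₀ hx0, zero_mul, hφ0] at hx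
  change φ x ≤ 1
  linarith

end KullbackLeibler

/-! ### Expectations under `bind`, `pure` and `map`. -/

section PMFExpectation

theorem PMF.tsum_bind_mul {α β : Type*} (p : PMF α) (g : α → PMF β) (f : β → ℝ≥0∞) :
    ∑' b, p.bind g b * f b = ∑' a, p a * ∑' b, g a b * f b := by
  simp only [PMF.bind_apply, ← ENNReal.tsum_mul_right, ← ENNReal.tsum_mul_left, mul_assoc]
  exact ENNReal.tsum_comm

theorem PMF.tsum_pure_mul {α : Type*} (a : α) (f : α → ℝ≥0∞) :
    ∑' b, PMF.pure a b * f b = f a := by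
  rw [tsum_eq_single a fun b hb => by simp [PMF.pure_apply, hb]]
  simp

theorem PMF.tsum_map_mul {α β : Type*} (p : PMF α) (g : α → β) (f : β → ℝ≥0∞) :
    ∑' b, p.map g b * f b = ∑' a, p a * f (g a) := by
  rw [PMF.map, PMF.tsum_bind_mul]
  simp only [Function.comp_apply, PMF.tsum_pure_mul]

end PMFExpectation

/-! ### Expectations over histories and supermartingale inequalities. -/

namespace BanditModel

variable {A Θ Y : Type*} [Fintype Y]

/-- Expectation of a function of the first `t` rounds. -/
noncomputable def expect (M : BanditModel A Θ Y) (θs : Θ) (t : ℕ)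
    (f : List (Θ × Y) → ℝ≥0∞) : ℝ≥0∞ :=
  ∑' h, M.tsLaw θs t h * f h

/-- Conditional expectation, given the history, of a function of the history after one more
round. -/
noncomputable def step [Fintype Θ] (M : BanditModel A Θ Y) (θs : Θ)
    (f : List (Θ × Y) → ℝ≥0∞) (h : List (Θ × Y)) : ℝ≥0∞ :=
  ∑ ϑ, M.posterior h ϑ * ∑ y, M.lik (M.opt ϑ) θs y * f ((ϑ, y) :: h)

section Expectation

variable (M : BanditModel A Θ Y) (θs : Θ)

theorem expect_zero (f : List (Θ × Y) → ℝ≥0∞) : M.expect θs 0 f = f [] :=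
  PMF.tsum_pure_mul _ _

theorem expect_mono (t : ℕ) {f g : List (Θ × Y) → ℝ≥0∞} (hfg : ∀ h, f h ≤ g h) :
    M.expect θs t f ≤ M.expect θs t g :=
  ENNReal.tsum_le_tsum fun h => mul_le_mul_right (hfg h) _

theorem expect_add_const (t : ℕ) (f : List (Θ × Y) → ℝ≥0∞) (c : ℝ≥0∞) :
    M.expect θs t (fun h => f h + c) = M.expect θs t f + c := by
  simp only [expect, mul_add, ENNReal.tsum_add, ENNReal.tsum_mul_right, PMF.tsum_coe, one_mul]

/-- Markov's inequality. -/
theorem mul_toOuterMeasure_le_expect (t : ℕ) (f : List (Θ × Y) → ℝ≥0∞) (c : ℝ≥0∞) :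
    c * (M.tsLaw θs t).toOuterMeasure {h | c ≤ f h} ≤ M.expect θs t f := by
  rw [PMF.toOuterMeasure_apply, ← ENNReal.tsum_mul_left]
  refine ENNReal.tsum_le_tsum fun h => ?_
  by_cases hh : h ∈ {h | c ≤ f h}
  · rw [Set.indicator_of_mem hh, mul_comm]
    exact mul_le_mul_right hh _
  · simp [Set.indicator_of_notMem hh]

theorem sum_lik (a : A) (θ : Θ) : ∑ y, M.lik a θ y = 1 := by
  rw [← tsum_fintype (L := .unconditional _), PMF.tsum_coe]

variable [Fintype Θ]

theorem expect_succ (t : ℕ) (f : List (Θ × Y) → ℝ≥0∞) :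
    M.expect θs (t + 1) f = M.expect θs t (M.step θs f) := by
  simp only [expect, tsLaw, PMF.tsum_bind_mul, PMF.tsum_map_mul, step, tsum_fintype]

theorem step_mono {f g : List (Θ × Y) → ℝ≥0∞} (h : List (Θ × Y))
    (hfg : ∀ e, f (e :: h) ≤ g (e :: h)) : M.step θs f h ≤ M.step θs g h :=
  Finset.sum_le_sum fun _ _ => mul_le_mul_right
    (Finset.sum_le_sum fun _ _ => mul_le_mul_right (hfg _) _) _

theorem sum_posterior (h : List (Θ × Y)) : ∑ θ, M.posterior h θ = 1 := by
  rw [← tsum_fintype (L := .unconditional _), PMF.tsum_coe]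

theorem step_of_const {f : List (Θ × Y) → ℝ≥0∞} {h : List (Θ × Y)} {c : ℝ≥0∞}
    (hf : ∀ e, f (e :: h) = c) : M.step θs f h = c := by
  simp only [step, hf, ← Finset.sum_mul, sum_lik, sum_posterior, one_mul]

theorem step_add (f g : List (Θ × Y) → ℝ≥0∞) (h : List (Θ × Y)) :
    M.step θs (fun h => f h + g h) h = M.step θs f h + M.step θs g h := by
  simp only [step, mul_add, Finset.sum_add_distrib]

theorem step_of_sample {f : List (Θ × Y) → ℝ≥0∞} {h : List (Θ × Y)} {g : Θ → ℝ≥0∞}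
    (hf : ∀ e, f (e :: h) = g e.1) : M.step θs f h = ∑ ϑ, M.posterior h ϑ * g ϑ := by
  simp only [step, hf, ← Finset.sum_mul, sum_lik, one_mul]

theorem expect_le_of_step_le {V : List (Θ × Y) → ℝ≥0∞} (hV : ∀ h, M.step θs V h ≤ V h) (t : ℕ) :
    M.expect θs t V ≤ V [] := by
  induction t with
  | zero => rw [expect_zero]
  | succ t ih =>
    rw [expect_succ]
    exact (M.expect_mono θs t hV).trans ih

theorem expect_le_of_step_le_add {V : List (Θ × Y) → ℝ≥0∞} {c : ℝ≥0∞}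
    (hV : ∀ h, M.step θs V h ≤ V h + c) (t : ℕ) :
    M.expect θs t V ≤ V [] + t * c := by
  induction t with
  | zero => simp [expect_zero]
  | succ t ih =>
    rw [expect_succ]
    refine (M.expect_mono θs t hV).trans ?_
    rw [expect_add_const]
    push_cast
    rw [add_mul, one_mul, ← add_assoc]
    gcongr

/-- Ville's inequality: a nonnegative supermartingale is unlikely ever to exceed a large level. -/
theorem mul_toOuterMeasure_exists_suffix_le {V : List (Θ × Y) → ℝ≥0∞}
    (hV : ∀ h, M.step θs V h ≤ V h) (c : ℝ≥0∞) (t : ℕ) :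
    c * (M.tsLaw θs t).toOuterMeasure {h | ∃ h', h' <:+ h ∧ c ≤ V h'} ≤ V [] := by
  classical
  -- The process stopped and capped at level `c`: still a supermartingale, so Markov at time `t`
  -- controls all earlier times. Suffixes are the earlier histories, as the latest round comes
  -- first.
  let W : List (Θ × Y) → ℝ≥0∞ := fun h => if ∃ h', h' <:+ h ∧ c ≤ V h' then c else V h
  have hle : ∀ h, W h ≤ V h ∨ ∃ h', h' <:+ h ∧ c ≤ V h' := by
    intro h
    by_cases hh : ∃ h', h' <:+ h ∧ c ≤ V h'
    · exact Or.inr hh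
    · exact Or.inl (by simp [W, hh])
  have hW : ∀ h, M.step θs W h ≤ W h := by
    intro h
    by_cases hh : ∃ h', h' <:+ h ∧ c ≤ V h'
    · have : ∀ e, W (e :: h) = c := by
        intro e
        obtain ⟨h', h1, h2⟩ := hh
        exact if_pos ⟨h', h1.trans (List.suffix_cons _ _), h2⟩
      rw [M.step_of_const θs this]
      simp [W, hh]
    · have hWh : W h = V h := by simp [W, hh]
      rw [hWh]
      refine (M.step_mono θs h fun e => ?_).trans (hV h)
      by_cases he : ∃ h', h' <:+ (e :: h) ∧ c ≤ V h'
      · obtain ⟨h', h1, h2⟩ := he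
        rcases List.suffix_cons_iff.1 h1 with rfl | h1
        · exact (if_pos ⟨_, List.suffix_rfl, h2⟩).trans_le h2
        · exact absurd ⟨h', h1, h2⟩ hh
      · exact (if_neg he).le
  have hset : {h | ∃ h', h' <:+ h ∧ c ≤ V h'} ⊆ {h | c ≤ W h} := by
    intro h hh
    have hh' : ∃ h', h' <:+ h ∧ c ≤ V h' := hh
    have hWc : W h = c := if_pos hh'
    exact hWc.symm.le
  refine (mul_le_mul_right ((M.tsLaw θs t).toOuterMeasure.mono hset) c).trans ?_
  refine (M.mul_toOuterMeasure_le_expect θs t W c).trans ?_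
  refine (M.expect_le_of_step_le θs hW t).trans ?_
  rcases hle [] with h | ⟨h', h1, h2⟩
  · exact h
  · rw [List.suffix_nil] at h1
    subst h1
    exact (if_pos ⟨_, List.suffix_rfl, h2⟩).trans_le h2

end Expectation

theorem div_nonneg (M : BanditModel A Θ Y) (θs θ : Θ) (a : A) : 0 ≤ M.div θs θ a :=
  klReal_nonneg _ _

/-! ### Runs of active actions and feasible paths. -/

section Paths

variable [Fintype A] (M : BanditModel A Θ Y) (θs : Θ) (L : ℝ)

/-- The action `a` is not yet eliminated at the play counts `z`. -/
def IsActive (z : A → ℕ) (a : A) : Prop :=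
  a ≠ M.opt θs ∧ ∃ θ ∈ M.exactMatch θs a, ∑ b, (z b : ℝ) * M.div θs θ b < L

variable {M θs L}

theorem weighted_div_mono {z z' : A → ℕ} (hz : z ≤ z') (θ : Θ) :
    ∑ b, (z b : ℝ) * M.div θs θ b ≤ ∑ b, (z' b : ℝ) * M.div θs θ b :=
  Finset.sum_le_sum fun b _ =>
    mul_le_mul_of_nonneg_right (Nat.cast_le.2 (hz b)) (M.div_nonneg θs θ b)

theorem IsActive.anti {z z' : A → ℕ} (hz : z ≤ z') {a : A} (h : M.IsActive θs L z' a) :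
    M.IsActive θs L z a :=
  ⟨h.1, h.2.imp fun θ hθ => ⟨hθ.1, (weighted_div_mono hz θ).trans_lt hθ.2⟩⟩

variable (M θs L) in
/-- A uniform bound on the play counts of eliminated actions. -/
noncomputable def countBound [Fintype Θ] : ℝ :=
  ∑ θ, ∑ j, ∑ a, (L + M.div θs θ j) / M.div θs θ a

/-- The slack `M.div θs θ j` pays for the last play, which may overshoot `L`. -/
theorem le_countBound [Fintype Θ] (hL : 0 ≤ L) {θ : Θ} {a j : A} (ha : 0 < M.div θs θ a)
    {x : ℝ} (hx : x * M.div θs θ a ≤ L + M.div θs θ j) : x ≤ M.countBound θs L := by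
  have hnn : ∀ θ j a, 0 ≤ (L + M.div θs θ j) / M.div θs θ a := fun θ j a =>
    _root_.div_nonneg (add_nonneg hL (M.div_nonneg θs θ j)) (M.div_nonneg θs θ a)
  refine ((le_div_iff₀ ha).2 hx).trans ?_
  refine (Finset.single_le_sum (f := fun a => (L + M.div θs θ j) / M.div θs θ a)
    (fun a _ => hnn θ j a) (Finset.mem_univ a)).trans ?_
  refine (Finset.single_le_sum (f := fun j => ∑ a, (L + M.div θs θ j) / M.div θs θ a)
    (fun j _ => Finset.sum_nonneg fun a _ => hnn θ j a) (Finset.mem_univ j)).trans ?_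
  exact Finset.single_le_sum (f := fun θ => ∑ j, ∑ a, (L + M.div θs θ j) / M.div θs θ a)
    (fun θ _ => Finset.sum_nonneg fun j _ => Finset.sum_nonneg fun a _ => hnn θ j a)
    (Finset.mem_univ θ)

theorem apply_mul_le_weighted_div (z : A → ℕ) (θ : Θ) (a : A) :
    (z a : ℝ) * M.div θs θ a ≤ ∑ b, (z b : ℝ) * M.div θs θ b :=
  Finset.single_le_sum (f := fun b => (z b : ℝ) * M.div θs θ b)
    (fun b _ => mul_nonneg (Nat.cast_nonneg _) (M.div_nonneg θs θ b)) (Finset.mem_univ a)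

variable [DecidableEq A]

variable (M θs L) in
/-- The play counts that arise from playing active actions only. -/
inductive Reachable : (A → ℕ) → Prop
  | zero : Reachable 0
  | play {z : A → ℕ} {a : A} : Reachable z → M.IsActive θs L z a → Reachable (z + Pi.single a 1)

variable (M θs L) in
/-- A sequence of play counts starting at zero, in which at every time either nothing or an active
action is played. -/
structure IsRun (w : ℕ → A → ℕ) : Prop where
  zero : w 0 = 0
  next : ∀ i, w (i + 1) = w i ∨
    ∃ a, M.IsActive θs L (w i) a ∧ w (i + 1) = w i + Pi.single a 1

theorem Reachable.exists_run {z : A → ℕ} (hz : M.Reachable θs L z) :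
    ∃ w, M.IsRun θs L w ∧ ∃ m, ∀ i, m ≤ i → w i = z := by
  induction hz with
  | zero => exact ⟨fun _ => 0, ⟨rfl, fun _ => Or.inl rfl⟩, 0, fun _ _ => rfl⟩
  | @play z a _ ha ih =>
    obtain ⟨w, hw, m, hm⟩ := ih
    refine ⟨fun i => if i ≤ m then w i else z + Pi.single a 1, ⟨by simp [hw.zero], fun i => ?_⟩,
      m + 1, fun i hi => if_neg (by omega)⟩
    rcases lt_trichotomy i m with h | rfl | h
    · simpa [h.le, Nat.succ_le_of_lt h] using hw.next i
    · refine Or.inr ⟨a, ?_⟩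
      simpa [hm i le_rfl] using ha
    · exact Or.inl (by simp [not_le.2 h, not_le.2 (Nat.lt_succ_of_lt h)])

variable (M θs) in
/-- Parameters that agree with `θs` on the optimal action, but have another optimal action `a`, are
told apart from `θs` by playing `a`. -/
def Separated : Prop :=
  ∀ a, a ≠ M.opt θs → ∀ θ ∈ M.exactMatch θs a, 0 < M.div θs θ a

theorem Reachable.apply_le [Fintype Θ] (hsep : M.Separated θs) (hL : 0 ≤ L) {z : A → ℕ}
    (hz : M.Reachable θs L z) (a : A) : (z a : ℝ) ≤ M.countBound θs L := by
  induction hz with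
  | zero =>
    simp only [Pi.zero_apply, Nat.cast_zero]
    exact Finset.sum_nonneg fun θ _ => Finset.sum_nonneg fun j _ => Finset.sum_nonneg fun a _ =>
      _root_.div_nonneg (add_nonneg hL (M.div_nonneg θs θ j)) (M.div_nonneg θs θ a)
  | @play z b _ hb ih =>
    by_cases hab : a = b
    · subst hab
      obtain ⟨hne, θ, hθ, hlt⟩ := hb
      refine le_countBound hL (hsep a hne θ hθ) (j := a) ?_
      have := (apply_mul_le_weighted_div (M := M) (θs := θs) z θ a).trans_lt hlt
      simp only [Pi.add_apply, Pi.single_eq_same]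
      push_cast
      linarith
    · simpa [Pi.single_eq_of_ne hab] using ih

/-- Each play raises the total count by one and the counts are bounded, so playing active actions
must end. -/
theorem Reachable.exists_terminal [Fintype Θ] (hsep : M.Separated θs) (hL : 0 ≤ L) {z : A → ℕ}
    (hz : M.Reachable θs L z) :
    ∃ z', M.Reachable θs L z' ∧ z ≤ z' ∧ ∀ a, ¬ M.IsActive θs L z' a := by
  have hbound : ∀ z, M.Reachable θs L z → ∑ a, z a ≤ Fintype.card A * ⌈M.countBound θs L⌉₊ := by
    intro z hz
    refine (Finset.sum_le_card_nsmul _ _ ⌈M.countBound θs L⌉₊ fun a _ => ?_).trans_eq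
      (by simp)
    exact_mod_cast (hz.apply_le hsep hL a).trans (Nat.le_ceil _)
  induction hn : Fintype.card A * ⌈M.countBound θs L⌉₊ - ∑ a, z a using Nat.strong_induction_on
    generalizing z with
  | _ n ih =>
    by_cases hact : ∃ a, M.IsActive θs L z a
    · obtain ⟨a, ha⟩ := hact
      have hz' := hz.play ha
      have hs : ∑ b, (z + Pi.single a 1 : A → ℕ) b = ∑ b, z b + 1 := by
        simp [Finset.sum_add_distrib]
      have hb := hbound _ hz'
      obtain ⟨z', h1, h2, h3⟩ := ih _ (by omega) hz' rfl
      exact ⟨z', h1, (le_add_of_nonneg_right zero_le).trans h2, h3⟩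
    · exact ⟨z, hz, le_rfl, not_exists.1 hact⟩

theorem IsRun.monotone {w : ℕ → A → ℕ} (hw : M.IsRun θs L w) : Monotone w := by
  refine monotone_nat_of_le_succ fun i => ?_
  rcases hw.next i with h | ⟨a, _, h⟩
  · exact h.ge
  · exact h ▸ le_add_of_nonneg_right zero_le

/-- Activity is antitone in the play counts, so an eliminated action never returns. -/
theorem IsRun.apply_eq_of_not_isActive {w : ℕ → A → ℕ} (hw : M.IsRun θs L w) {a : A} {k i : ℕ}
    (hki : k ≤ i) (ha : ¬ M.IsActive θs L (w k) a) : w i a = w k a := by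
  induction i, hki using Nat.le_induction with
  | base => rfl
  | succ i hki ih =>
    rcases hw.next i with h | ⟨b, hb, h⟩
    · rw [h, ih]
    · have hab : a ≠ b := by
        rintro rfl
        exact ha (hb.anti (hw.monotone hki))
      rw [h, Pi.add_apply, Pi.single_eq_of_ne hab, add_zero, ih]

theorem exists_enumeration_monotone (a₀ : A) (τ : A → ℕ) :
    ∃ act : Fin (Fintype.card A - 1) → A, (∀ k, act k ≠ a₀) ∧ Function.Injective act ∧
      Monotone (τ ∘ act) ∧ ∀ f : A → ℕ, ∑ k, f (act k) = ∑ a ∈ Finset.univ.erase a₀, f a := by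
  have hcard : (Finset.univ.erase a₀).card = Fintype.card A - 1 := by
    rw [Finset.card_erase_of_mem (Finset.mem_univ _), Finset.card_univ]
  let e := ((Finset.univ.erase a₀).equivFinOfCardEq hcard).symm
  let σ := Tuple.sort fun k => τ (e k)
  refine ⟨fun k => e (σ k), fun k => Finset.ne_of_mem_erase (e (σ k)).2, fun i j hij => ?_,
    Tuple.monotone_sort fun k => τ (e k), fun f => ?_⟩
  · exact σ.injective (e.injective (Subtype.ext hij))
  · rw [← Finset.sum_coe_sort (Finset.univ.erase a₀) f]
    exact Equiv.sum_comp (σ.trans e) fun a => f a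

/-- Along a run to a terminal state, `τ a` is the elimination time of `a`. With actions sorted by
`τ`, the counts at these times form a path; an action's count no longer changes after its
elimination, so the objective is the total terminal count. -/
theorem Reachable.exists_pathValue_ge [Fintype Θ] (hsep : M.Separated θs) (hL : 0 < L) {z : A → ℕ}
    (hz : M.Reachable θs L z) :
    ∃ v ∈ M.pathValues θs L, ∑ a ∈ Finset.univ.erase (M.opt θs), z a ≤ v := by
  classical
  obtain ⟨z', hz', hle, hter⟩ := hz.exists_terminal hsep hL.le
  obtain ⟨w, hw, m, hm⟩ := hz'.exists_run
  have hex : ∀ a, ∃ i, ¬ M.IsActive θs L (w i) a := fun a => ⟨m, hm m le_rfl ▸ hter a⟩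
  let τ : A → ℕ := fun a => Nat.find (hex a)
  have hτ : ∀ a, ¬ M.IsActive θs L (w (τ a)) a := fun a => Nat.find_spec (hex a)
  have hwopt : ∀ i, w i (M.opt θs) = 0 := by
    intro i
    rw [hw.apply_eq_of_not_isActive (Nat.zero_le i) fun h => h.1 rfl, hw.zero, Pi.zero_apply]
  obtain ⟨act, hne, hinj, hmono, hsum⟩ := exists_enumeration_monotone (M.opt θs) τ
  have hlim : ∀ a, w (τ a) a = z' a := by
    intro a
    rw [← hw.apply_eq_of_not_isActive (le_max_left (τ a) m) (hτ a), hm _ (le_max_right _ _)]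
  refine ⟨_, ⟨fun k => w (τ (act k)), act, ?_, rfl⟩, ?_⟩
  · refine ⟨fun k => hwopt _, hne, hinj, fun k i hki => hw.monotone (hmono hki),
      fun k i hki => hw.apply_eq_of_not_isActive (hmono hki) (hτ _), fun k θ hθ => ?_,
      fun k hk => ?_, fun k hk => ?_⟩
    · by_contra hlt
      exact hτ (act k) ⟨hne k, θ, hθ, not_le.1 hlt⟩
    -- Since `L > 0`, an action with nonempty `S'_a` is active at zero counts, so its elimination
    -- has a preceding time.
    · have hτ0 : τ (act k) ≠ 0 := by
        intro h0
        obtain ⟨θ, hθ⟩ := hk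
        refine hτ (act k) ⟨hne k, θ, hθ, ?_⟩
        simpa [h0, hw.zero] using hL
      obtain ⟨i, hi⟩ := Nat.exists_eq_succ_of_ne_zero hτ0
      have hact : M.IsActive θs L (w i) (act k) := by
        by_contra hcon
        have := Nat.find_min' (hex (act k)) hcon
        change τ (act k) ≤ i at this
        omega
      -- An idle step eliminates nothing; otherwise taking back the play of `j` restores the counts
      -- at which the action was active.
      rcases hw.next i with h | ⟨j, hj, h⟩
      · have hna := hτ (act k)
        rw [hi, Nat.succ_eq_add_one, h] at hna
        exact absurd hact hna
      · obtain ⟨_, θ, hθ, hlt⟩ := hact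
        refine ⟨j, hj.1, θ, hθ, lt_of_eq_of_lt (Finset.sum_congr rfl fun a _ => ?_) hlt⟩
        rw [hi, Nat.succ_eq_add_one, h]
        by_cases haj : a = j
        · subst haj
          simp
        · simp [haj]
    · have hτ0 : τ (act k) = 0 := by
        refine (Nat.find_eq_zero _).2 fun h => ?_
        obtain ⟨_, θ, hθ, _⟩ := h
        simp [hk] at hθ
      simp [hτ0, hw.zero]
  · simp only [hlim]
    rw [hsum]
    exact Finset.sum_le_sum fun a _ => hle a

theorem bddAbove_pathValues [Fintype Θ] (hsep : M.Separated θs) (hL : 0 ≤ L) :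
    BddAbove (M.pathValues θs L) := by
  refine ⟨(Fintype.card A - 1) * ⌈M.countBound θs L⌉₊, ?_⟩
  rintro v ⟨z, act, h, rfl⟩
  refine (Finset.sum_le_card_nsmul _ _ ⌈M.countBound θs L⌉₊ fun k _ => ?_).trans_eq (by simp)
  rcases (M.exactMatch θs (act k)).eq_empty_or_nonempty with hk | hk
  · simp [h.of_empty k hk]
  obtain ⟨j, _, θ, hθ, hlt⟩ := h.just_reached k hk
  have hsplit : ∑ a, ((z k a : ℝ) - if a = j then 1 else 0) * M.div θs θ a =
      ∑ a, (z k a : ℝ) * M.div θs θ a - M.div θs θ j := by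
    simp [sub_mul, Finset.sum_sub_distrib]
  rw [hsplit] at hlt
  have := apply_mul_le_weighted_div (M := M) (θs := θs) (z k) θ (act k)
  have hle := le_countBound hL (hsep _ (h.act_ne k) θ hθ) (j := j) (x := z k (act k)) (by linarith)
  exact_mod_cast hle.trans (Nat.le_ceil _)

theorem exists_isGreatest_pathValues [Fintype Θ] (hsep : M.Separated θs) (hL : 0 < L) :
    ∃ C, IsGreatest (M.pathValues θs L) C := by
  obtain ⟨v, hv, _⟩ := (Reachable.zero (M := M) (θs := θs) (L := L)).exists_pathValue_ge hsep hL
  have hbdd := M.bddAbove_pathValues hsep hL.le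
  exact ⟨_, Nat.sSup_mem ⟨v, hv⟩ hbdd, fun x hx => le_csSup hbdd hx⟩

end Paths

/-- If `θ` also agreed with `θs` on its own optimal action, that action would do at least as well as
`M.opt θs` under `θs`, against uniqueness. -/
theorem separated_of_unique_opt (M : BanditModel A Θ Y) (θs : Θ)
    (hlik : ∀ a θ y, 0 < (M.lik a θ y).toReal)
    (hopt : ∀ a, a ≠ M.opt θs → M.meanReward a θs < M.meanReward (M.opt θs) θs) :
    M.Separated θs := by
  rintro a ha θ ⟨rfl, h0⟩
  refine (M.div_nonneg θs θ _).lt_of_ne fun h => ?_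
  have h1 := eq_of_klReal_eq_zero _ _ (hlik _ _) (hlik _ _) h.symm
  have h2 := eq_of_klReal_eq_zero _ _ (hlik _ _) (hlik _ _) h0
  have h3 := M.opt_isMax θ (M.opt θs)
  rw [← h1, ← h2] at h3
  exact (hopt _ ha).not_ge h3

end BanditModel

theorem ENNReal.le_of_div_mul_le {b c x : ℝ≥0∞} (hb : b ≠ 0) (hb' : b ≠ ∞) (hc : c ≠ 0)
    (hc' : c ≠ ∞) (h : b / c * x ≤ b) : x ≤ c := by
  have h1 : b / c * x ≤ b / c * c := by rwa [ENNReal.div_mul_cancel hc hc']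
  exact (ENNReal.mul_le_mul_iff_right (ENNReal.div_ne_zero.2 ⟨hb, hc'⟩)
    (ENNReal.div_ne_top hb' hc)).1 h1

namespace BanditModel

variable {A Θ Y : Type*} [Fintype Y]

theorem lik_ne_zero {M : BanditModel A Θ Y} (hlik : ∀ a θ y, 0 < (M.lik a θ y).toReal) (a : A)
    (θ : Θ) (y : Y) : M.lik a θ y ≠ 0 :=
  fun h => by simpa [h] using hlik a θ y

/-! ### The posterior and its martingale. -/

section Posterior

variable [Fintype Θ] (M : BanditModel A Θ Y)

/-- The predictive probability of the observation `e.2` after playing the action sampled with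
`e.1`. -/
noncomputable def evidence (h : List (Θ × Y)) (e : Θ × Y) : ℝ≥0∞ :=
  ∑ θ, M.lik (M.opt e.1) θ e.2 * M.posterior h θ

theorem evidence_ne_top (h : List (Θ × Y)) (e : Θ × Y) : M.evidence h e ≠ ∞ :=
  ENNReal.sum_ne_top.2 fun _ _ => ENNReal.mul_ne_top (PMF.apply_ne_top _ _) (PMF.apply_ne_top _ _)

theorem sum_evidence (h : List (Θ × Y)) (ϑ : Θ) : ∑ y, M.evidence h (ϑ, y) = 1 := by
  simp only [evidence]
  rw [Finset.sum_comm]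
  simp only [← Finset.sum_mul, sum_lik, one_mul, sum_posterior]

variable {M}

theorem evidence_ne_zero (hlik : ∀ a θ y, 0 < (M.lik a θ y).toReal) (h : List (Θ × Y))
    (e : Θ × Y) : M.evidence h e ≠ 0 := by
  intro h0
  obtain ⟨θ, hθ⟩ := (M.posterior h).support_nonempty
  have := Finset.sum_eq_zero_iff.1 h0 θ (Finset.mem_univ θ)
  exact mul_ne_zero (lik_ne_zero hlik _ _ _) ((PMF.mem_support_iff _ _).1 hθ) this

theorem posterior_cons (hlik : ∀ a θ y, 0 < (M.lik a θ y).toReal) (e : Θ × Y)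
    (h : List (Θ × Y)) (θ : Θ) : M.posterior (e :: h) θ =
      M.lik (M.opt e.1) θ e.2 * M.posterior h θ * (M.evidence h e)⁻¹ := by
  have hsum : ∑' θ, M.lik (M.opt e.1) θ e.2 * M.posterior h θ = M.evidence h e :=
    tsum_fintype (L := .unconditional _) _
  have hcond : (∑' θ, M.lik (M.opt e.1) θ e.2 * M.posterior h θ) ≠ 0 ∧
      (∑' θ, M.lik (M.opt e.1) θ e.2 * M.posterior h θ) ≠ ∞ := by
    rw [hsum]
    exact ⟨evidence_ne_zero hlik h e, M.evidence_ne_top h e⟩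
  rw [← hsum]
  change bayesUpdate _ _ _ = _
  rw [bayesUpdate, dif_pos hcond, PMF.normalize_apply]

theorem posterior_ne_zero (hlik : ∀ a θ y, 0 < (M.lik a θ y).toReal) {θs : Θ}
    (hprior : M.prior θs ≠ 0) (h : List (Θ × Y)) : M.posterior h θs ≠ 0 := by
  induction h with
  | nil => exact hprior
  | cons e h ih =>
    rw [posterior_cons hlik]
    exact mul_ne_zero (mul_ne_zero (lik_ne_zero hlik _ _ _) ih)
      (ENNReal.inv_ne_zero.2 (M.evidence_ne_top h e))

/-- Under the true parameter, the inverse of its posterior weight is a martingale. -/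
theorem step_inv_posterior (hlik : ∀ a θ y, 0 < (M.lik a θ y).toReal) {θs : Θ}
    (hprior : M.prior θs ≠ 0) (h : List (Θ × Y)) :
    M.step θs (fun h => (M.posterior h θs)⁻¹) h = (M.posterior h θs)⁻¹ := by
  -- The true likelihood cancels, leaving the predictive probability, which sums to one over `y`.
  have key : ∀ ϑ y, M.lik (M.opt ϑ) θs y * (M.posterior ((ϑ, y) :: h) θs)⁻¹ =
      M.evidence h (ϑ, y) * (M.posterior h θs)⁻¹ := by
    intro ϑ y
    have h1 := lik_ne_zero hlik (M.opt ϑ) θs y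
    have h2 : M.lik (M.opt ϑ) θs y ≠ ∞ := PMF.apply_ne_top _ _
    have h3 := posterior_ne_zero hlik hprior h
    have h4 : M.posterior h θs ≠ ∞ := PMF.apply_ne_top _ _
    rw [posterior_cons hlik, ENNReal.mul_inv (Or.inl (mul_ne_zero h1 h3))
      (Or.inl (ENNReal.mul_ne_top h2 h4)), ENNReal.mul_inv (Or.inl h1) (Or.inl h2), inv_inv,
      ← mul_assoc, ← mul_assoc, ENNReal.mul_inv_cancel h1 h2, one_mul, mul_comm]
  simp only [step, key, ← Finset.sum_mul, sum_evidence, one_mul, sum_posterior]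

end Posterior

/-! ### Log-likelihood ratios and decay of the posterior. -/

section LogRatio

variable (M : BanditModel A Θ Y) (θs θ : Θ)

/-- The log-likelihood ratio of `θ` and `θs` for an observation. -/
noncomputable def logRatio (a : A) (y : Y) : ℝ :=
  Real.log (M.lik a θ y).toReal - Real.log (M.lik a θs y).toReal

/-- The log-likelihood ratio of `θ` and `θs` for a history. -/
noncomputable def totalLogRatio (h : List (Θ × Y)) : ℝ :=
  (h.map fun e => M.logRatio θs θ (M.opt e.1) e.2).sum

/-- The total divergence of `θ` from `θs` accumulated by the plays of a history. -/
noncomputable def totalDiv (h : List (Θ × Y)) : ℝ :=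
  (h.map fun e => M.div θs θ (M.opt e.1)).sum

/-- The log-likelihood ratio, recentered by a proportion `1 - ε` of its mean. -/
noncomputable def score (ε : ℝ) (h : List (Θ × Y)) : ℝ :=
  M.totalLogRatio θs θ h + (1 - ε) * M.totalDiv θs θ h

theorem playCount_cons [DecidableEq A] (e : Θ × Y) (h : List (Θ × Y)) (a : A) :
    M.playCount (e :: h) a = M.playCount h a + if M.opt e.1 = a then 1 else 0 := by
  simp [playCount, List.countP_cons]

theorem totalDiv_eq_sum [Fintype A] [DecidableEq A] (h : List (Θ × Y)) :
    M.totalDiv θs θ h = ∑ a, (M.playCount h a : ℝ) * M.div θs θ a := by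
  induction h with
  | nil => simp [totalDiv, playCount]
  | cons e h ih =>
    simp only [playCount_cons, Nat.cast_add, add_mul, Finset.sum_add_distrib, ← ih]
    simp [totalDiv, add_comm]

theorem playCount_mul_le_totalDiv [DecidableEq A] (h : List (Θ × Y)) (a : A) :
    (M.playCount h a : ℝ) * M.div θs θ a ≤ M.totalDiv θs θ h := by
  induction h with
  | nil => simp [totalDiv, playCount]
  | cons e h ih =>
    have hD : M.totalDiv θs θ (e :: h) = M.div θs θ (M.opt e.1) + M.totalDiv θs θ h := by
      simp [totalDiv]
    rw [hD, playCount_cons]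
    have := M.div_nonneg θs θ (M.opt e.1)
    split_ifs with he
    · subst he
      push_cast
      linarith
    · push_cast
      linarith

variable {M θs θ}

/-- Bayes' rule for the posterior odds, where the normalizing constants cancel; multiplied out to
allow `M.prior θ = 0`. -/
theorem posterior_mul_prior [Fintype Θ] (hlik : ∀ a θ y, 0 < (M.lik a θ y).toReal)
    (h : List (Θ × Y)) : M.posterior h θ * M.prior θs =
      M.posterior h θs * M.prior θ * ENNReal.ofReal (Real.exp (M.totalLogRatio θs θ h)) := by
  induction h with
  | nil => simp [posterior, totalLogRatio, mul_comm]
  | cons e h ih =>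
    have hl : M.lik (M.opt e.1) θ e.2 = M.lik (M.opt e.1) θs e.2 *
        ENNReal.ofReal (Real.exp (M.logRatio θs θ (M.opt e.1) e.2)) := by
      rw [logRatio, Real.exp_sub, Real.exp_log (hlik _ _ _), Real.exp_log (hlik _ _ _),
        ENNReal.ofReal_div_of_pos (hlik _ _ _), ENNReal.ofReal_toReal (PMF.apply_ne_top _ _),
        ENNReal.ofReal_toReal (PMF.apply_ne_top _ _),
        ENNReal.mul_div_cancel (lik_ne_zero hlik _ _ _) (PMF.apply_ne_top _ _)]
    have ht : M.totalLogRatio θs θ (e :: h) =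
        M.logRatio θs θ (M.opt e.1) e.2 + M.totalLogRatio θs θ h := by
      simp [totalLogRatio]
    rw [posterior_cons hlik, posterior_cons hlik, ht, Real.exp_add,
      ENNReal.ofReal_mul (Real.exp_pos _).le, hl]
    calc _ = M.lik (M.opt e.1) θs e.2 *
          ENNReal.ofReal (Real.exp (M.logRatio θs θ (M.opt e.1) e.2)) * (M.evidence h e)⁻¹ *
          (M.posterior h θ * M.prior θs) := by ring
      _ = _ := by rw [ih]; ring

theorem posterior_le_of_score_le [Fintype Θ] (hlik : ∀ a θ y, 0 < (M.lik a θ y).toReal)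
    (hprior : M.prior θs ≠ 0) {ε s : ℝ} {h : List (Θ × Y)} (hs : M.score θs θ ε h ≤ s) :
    M.posterior h θ ≤
      (M.prior θs)⁻¹ * ENNReal.ofReal (Real.exp (s - (1 - ε) * M.totalDiv θs θ h)) := by
  have hle : M.posterior h θ * M.prior θs ≤
      ENNReal.ofReal (Real.exp (s - (1 - ε) * M.totalDiv θs θ h)) := by
    rw [posterior_mul_prior hlik]
    refine (mul_le_of_le_one_left' (mul_le_one' (PMF.coe_le_one _ _) (PMF.coe_le_one _ _))).trans ?_
    refine ENNReal.ofReal_le_ofReal (Real.exp_le_exp.2 ?_)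
    rw [score] at hs
    linarith
  rw [← ENNReal.div_eq_inv_mul]
  exact ENNReal.le_div_iff_mul_le (Or.inl hprior) (Or.inl (PMF.apply_ne_top _ _)) |>.2 hle

/-- The score increment has exponential moment at most one whichever action is played, so the
sampling rule is irrelevant. -/
theorem step_exp_score_le [Fintype Θ] {x ε : ℝ}
    (hx : ∀ a, ∑ y, (M.lik a θs y).toReal *
      Real.exp (x * (M.logRatio θs θ a y + (1 - ε) * M.div θs θ a)) ≤ 1) (h : List (Θ × Y)) :
    M.step θs (fun h => ENNReal.ofReal (Real.exp (x * M.score θs θ ε h))) h ≤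
      ENNReal.ofReal (Real.exp (x * M.score θs θ ε h)) := by
  have key : ∀ ϑ, ∑ y, M.lik (M.opt ϑ) θs y *
      ENNReal.ofReal (Real.exp (x * M.score θs θ ε ((ϑ, y) :: h))) ≤
        ENNReal.ofReal (Real.exp (x * M.score θs θ ε h)) := by
    intro ϑ
    have hterm : ∀ y, M.lik (M.opt ϑ) θs y *
        ENNReal.ofReal (Real.exp (x * M.score θs θ ε ((ϑ, y) :: h))) =
        ENNReal.ofReal ((M.lik (M.opt ϑ) θs y).toReal * Real.exp
          (x * (M.logRatio θs θ (M.opt ϑ) y + (1 - ε) * M.div θs θ (M.opt ϑ)))) *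
          ENNReal.ofReal (Real.exp (x * M.score θs θ ε h)) := by
      intro y
      have hsc : x * M.score θs θ ε ((ϑ, y) :: h) =
          x * (M.logRatio θs θ (M.opt ϑ) y + (1 - ε) * M.div θs θ (M.opt ϑ)) +
            x * M.score θs θ ε h := by
        simp only [score, totalLogRatio, totalDiv, List.map_cons, List.sum_cons]
        ring
      rw [hsc, Real.exp_add, ENNReal.ofReal_mul (Real.exp_pos _).le,
        ENNReal.ofReal_mul ENNReal.toReal_nonneg, ENNReal.ofReal_toReal (PMF.apply_ne_top _ _),
        mul_assoc]
    simp only [hterm, ← Finset.sum_mul]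
    rw [← ENNReal.ofReal_sum_of_nonneg fun y _ =>
      mul_nonneg ENNReal.toReal_nonneg (Real.exp_pos _).le]
    exact mul_le_of_le_one_left' (ENNReal.ofReal_le_one.2 (hx _))
  calc _ ≤ ∑ ϑ, M.posterior h ϑ * ENNReal.ofReal (Real.exp (x * M.score θs θ ε h)) :=
        Finset.sum_le_sum fun ϑ _ => mul_le_mul_right (key ϑ) _
    _ = _ := by rw [← Finset.sum_mul, sum_posterior, one_mul]

theorem exists_step_exp_score_le [Fintype A] [Fintype Θ]
    (hlik : ∀ a θ y, 0 < (M.lik a θ y).toReal) {ε : ℝ} (hε : 0 < ε) :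
    ∃ x : ℝ, 0 < x ∧ ∀ θ a, ∑ y, (M.lik a θs y).toReal *
      Real.exp (x * (M.logRatio θs θ a y + (1 - ε) * M.div θs θ a)) ≤ 1 := by
  have h : ∀ᶠ x : ℝ in nhdsWithin 0 (Set.Ioi 0), ∀ θ a, ∑ y, (M.lik a θs y).toReal *
      Real.exp (x * (M.logRatio θs θ a y + (1 - ε) * M.div θs θ a)) ≤ 1 :=
    Filter.eventually_all.2 fun θ => Filter.eventually_all.2 fun a =>
      eventually_sum_exp_le_one (M.lik a θs) (M.lik a θ) (hlik a θs) (hlik a θ) hε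
  obtain ⟨x, hx, hx0⟩ := (h.and self_mem_nhdsWithin).exists
  exact ⟨x, hx0, hx⟩

end LogRatio

/-! ### Good histories. -/

section GoodHistories

variable (M : BanditModel A Θ Y) (θs : Θ)

/-- All along the history, the true parameter keeps posterior weight at least `p`, and the
recentered log-likelihood ratios stay below `s`. -/
def Good (ε : ℝ) (p : ℝ≥0∞) (s : ℝ) (h : List (Θ × Y)) : Prop :=
  ∀ h', h' <:+ h → p ≤ M.posterior h' θs ∧ ∀ θ, M.score θs θ ε h' ≤ s

variable {M θs}

theorem Good.self {ε : ℝ} {p : ℝ≥0∞} {s : ℝ} {h : List (Θ × Y)} (hg : M.Good θs ε p s h) :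
    p ≤ M.posterior h θs ∧ ∀ θ, M.score θs θ ε h ≤ s :=
  hg h List.suffix_rfl

theorem Good.tail {ε : ℝ} {p : ℝ≥0∞} {s : ℝ} {e : Θ × Y} {h : List (Θ × Y)}
    (hg : M.Good θs ε p s (e :: h)) : M.Good θs ε p s h :=
  fun h' hh' => hg h' (hh'.trans (List.suffix_cons _ _))

/-- Ville's inequality twice: the inverse posterior weight starts at `v` and gets level `v / η`;
each exponential score starts at one and gets a level that leaves probability `η / card Θ` per
parameter. -/
theorem exists_toOuterMeasure_not_good_le [Fintype A] [Fintype Θ]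
    (hlik : ∀ a θ y, 0 < (M.lik a θ y).toReal) (hprior : M.prior θs ≠ 0) {ε : ℝ} (hε : 0 < ε)
    {η : ℝ≥0∞} (hη : η ≠ 0) (hη' : η ≠ ∞) :
    ∃ p : ℝ≥0∞, p ≠ 0 ∧ p ≠ ∞ ∧ ∃ s : ℝ, ∀ t,
      (M.tsLaw θs t).toOuterMeasure {h | ¬ M.Good θs ε p s h} ≤ η + η := by
  obtain ⟨x, hx0, hx⟩ := exists_step_exp_score_le (θs := θs) hlik hε
  have hcard : (Fintype.card Θ : ℝ≥0∞) ≠ 0 := by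
    have : Nonempty Θ := ⟨θs⟩
    simp
  have hcard' : (Fintype.card Θ : ℝ≥0∞) ≠ ∞ := ENNReal.natCast_ne_top _
  let v := (M.prior θs)⁻¹
  have hv : v ≠ 0 := ENNReal.inv_ne_zero.2 (PMF.apply_ne_top _ _)
  have hv' : v ≠ ∞ := ENNReal.inv_ne_top.2 hprior
  let η₂ := η / Fintype.card Θ
  have hη₂ : η₂ ≠ 0 := ENNReal.div_ne_zero.2 ⟨hη, hcard'⟩
  have hη₂' : η₂ ≠ ∞ := ENNReal.div_ne_top hη' hcard
  let c := (1 : ℝ≥0∞) / η₂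
  have hc : c ≠ 0 := ENNReal.div_ne_zero.2 ⟨one_ne_zero, hη₂'⟩
  have hc' : c ≠ ∞ := ENNReal.div_ne_top ENNReal.one_ne_top hη₂
  refine ⟨(v / η)⁻¹, ENNReal.inv_ne_zero.2 (ENNReal.div_ne_top hv' hη),
    ENNReal.inv_ne_top.2 (ENNReal.div_ne_zero.2 ⟨hv, hη'⟩), Real.log c.toReal / x, fun t => ?_⟩
  have h1 := M.mul_toOuterMeasure_exists_suffix_le θs
    (fun h => (step_inv_posterior hlik hprior h).le) (v / η) t
  have h1' := ENNReal.le_of_div_mul_le hv hv' hη hη' h1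
  have h2 : ∀ θ, (M.tsLaw θs t).toOuterMeasure {h | ∃ h', h' <:+ h ∧
      c ≤ ENNReal.ofReal (Real.exp (x * M.score θs θ ε h'))} ≤ η₂ := by
    intro θ
    have h2 := M.mul_toOuterMeasure_exists_suffix_le θs
      (fun h => step_exp_score_le (θ := θ) (hx θ) h) c t
    simp only [score, totalLogRatio, totalDiv, List.map_nil, List.sum_nil, mul_zero, add_zero,
      Real.exp_zero, ENNReal.ofReal_one] at h2
    exact ENNReal.le_of_div_mul_le one_ne_zero ENNReal.one_ne_top hη₂ hη₂' h2
  have hsub : {h | ¬ M.Good θs ε (v / η)⁻¹ (Real.log c.toReal / x) h} ⊆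
      {h | ∃ h', h' <:+ h ∧ v / η ≤ (M.posterior h' θs)⁻¹} ∪
        ⋃ θ, {h | ∃ h', h' <:+ h ∧ c ≤ ENNReal.ofReal (Real.exp (x * M.score θs θ ε h'))} := by
    intro h hh
    have hh : ¬ M.Good θs ε (v / η)⁻¹ (Real.log c.toReal / x) h := hh
    simp only [Good, not_forall, not_and_or] at hh
    obtain ⟨h', hs, hh⟩ := hh
    rcases hh with hh | ⟨θ, hh⟩
    · refine Or.inl ⟨h', hs, ?_⟩
      rw [ENNReal.le_inv_iff_le_inv]
      exact (not_le.1 hh).le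
    · refine Or.inr (Set.mem_iUnion.2 ⟨θ, h', hs, ?_⟩)
      rw [not_le, div_lt_iff₀ hx0, mul_comm] at hh
      rw [← ENNReal.ofReal_toReal hc', ← Real.exp_log (ENNReal.toReal_pos hc hc')]
      exact ENNReal.ofReal_le_ofReal (Real.exp_le_exp.2 hh.le)
  refine (MeasureTheory.measure_mono hsub).trans ((MeasureTheory.measure_union_le _ _).trans ?_)
  refine add_le_add h1' ((MeasureTheory.measure_iUnion_fintype_le _ _).trans ?_)
  refine (Finset.sum_le_sum fun θ _ => h2 θ).trans_eq ?_
  rw [Finset.sum_const, Finset.card_univ, nsmul_eq_mul, ENNReal.mul_div_cancel hcard hcard']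

end GoodHistories

/-! ### Late plays. -/

section LatePlays

variable (M : BanditModel A Θ Y) (θs : Θ)

/-- Some parameter was sampled although its accumulated divergence from `θs` had reached `L`,
after a good history. -/
def LatePlay (ε : ℝ) (p : ℝ≥0∞) (s L : ℝ) : List (Θ × Y) → Prop
  | [] => False
  | e :: h => LatePlay ε p s L h ∨ (M.Good θs ε p s h ∧ L ≤ M.totalDiv θs e.1 h)

variable {M θs}

theorem toOuterMeasure_latePlay_le [Fintype Θ] (hlik : ∀ a θ y, 0 < (M.lik a θ y).toReal)
    (hprior : M.prior θs ≠ 0) {ε : ℝ} (hε : ε < 1) (p : ℝ≥0∞) (s L : ℝ) (t : ℕ) :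
    (M.tsLaw θs t).toOuterMeasure {h | M.LatePlay θs ε p s L h} ≤
      t * (Fintype.card Θ *
        ((M.prior θs)⁻¹ * ENNReal.ofReal (Real.exp (s - (1 - ε) * L)))) := by
  classical
  set q : ℝ≥0∞ := (M.prior θs)⁻¹ * ENNReal.ofReal (Real.exp (s - (1 - ε) * L))
  let V : List (Θ × Y) → ℝ≥0∞ := fun h => if M.LatePlay θs ε p s L h then 1 else 0
  have hstep : ∀ h, M.step θs V h ≤ V h + Fintype.card Θ * q := by
    intro h
    let g : Θ → ℝ≥0∞ := fun ϑ => if M.Good θs ε p s h ∧ L ≤ M.totalDiv θs ϑ h then 1 else 0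
    have hle : ∀ e, V (e :: h) ≤ V h + g e.1 := by
      intro e
      by_cases he : M.LatePlay θs ε p s L (e :: h)
      · have h1 : V (e :: h) = 1 := if_pos he
        rw [h1]
        rcases he with he | he
        · exact le_add_of_le_of_nonneg (if_pos (c := M.LatePlay θs ε p s L h) he).ge zero_le
        · refine le_add_of_nonneg_of_le zero_le (Eq.ge ?_)
          exact if_pos he
      · have h0 : V (e :: h) = 0 := if_neg he
        simp [h0]
    -- The default `θs` is never used: `step` evaluates its argument only at nonempty histories `e
    -- :: h`.
    have hg : M.step θs (fun h' => g (h'.head?.elim θs Prod.fst)) h ≤ Fintype.card Θ * q := by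
      rw [M.step_of_sample θs (g := g) fun e => rfl]
      refine (Finset.sum_le_card_nsmul _ _ q fun ϑ _ => ?_).trans_eq
        (by rw [nsmul_eq_mul, Finset.card_univ])
      by_cases hϑ : M.Good θs ε p s h ∧ L ≤ M.totalDiv θs ϑ h
      · simp only [g, if_pos hϑ, mul_one]
        refine (posterior_le_of_score_le hlik hprior (hϑ.1.self.2 ϑ)).trans ?_
        refine mul_le_mul_right (ENNReal.ofReal_le_ofReal (Real.exp_le_exp.2 ?_)) _
        have := mul_le_mul_of_nonneg_left hϑ.2 (sub_nonneg.2 hε.le)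
        linarith
      · simp [g, if_neg hϑ]
    calc M.step θs V h
        ≤ M.step θs (fun h' => V h'.tail + g (h'.head?.elim θs Prod.fst)) h :=
          M.step_mono θs h hle
      _ = V h + M.step θs (fun h' => g (h'.head?.elim θs Prod.fst)) h := by
          rw [M.step_add θs (fun h' => V h'.tail), M.step_of_const θs (c := V h) (fun e => rfl)]
      _ ≤ _ := by gcongr
  have hsub : {h | M.LatePlay θs ε p s L h} ⊆ {h | 1 ≤ V h} := by
    intro h hh
    have hV : V h = 1 := if_pos hh
    exact hV.ge
  have h1 := M.mul_toOuterMeasure_le_expect θs t V 1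
  rw [one_mul] at h1
  refine (MeasureTheory.measure_mono hsub).trans (h1.trans ?_)
  refine (M.expect_le_of_step_le_add θs hstep t).trans_eq ?_
  simp [V, LatePlay]

end LatePlays

/-! ### Misfits. -/

section Misfits

variable (M : BanditModel A Θ Y) (θs : Θ)

open Classical in
/-- The number of rounds in which, after a good history, a parameter was sampled that disagrees
with `θs` on the optimal action. -/
noncomputable def misfitCount (ε : ℝ) (p : ℝ≥0∞) (s : ℝ) : List (Θ × Y) → ℕ
  | [] => 0
  | e :: h => misfitCount ε p s h +
      if M.Good θs ε p s h ∧ M.div θs e.1 (M.opt θs) ≠ 0 then 1 else 0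

variable {M θs}

/-- With `U = exp (-c * N)` on good histories, a misfit has conditional probability at most `K * U`,
while `U` contracts by the factor `1 - q` in mean because `θs` itself is drawn with probability at
least `p`. Hence the misfit count plus `(K / q) * U` is a supermartingale, and Markov's inequality
applies uniformly in `t`. -/
theorem exists_toOuterMeasure_misfitCount_le [Fintype Θ]
    (hlik : ∀ a θ y, 0 < (M.lik a θ y).toReal) (hprior : M.prior θs ≠ 0) {ε : ℝ} (hε : ε < 1)
    {p : ℝ≥0∞} (hp : p ≠ 0) (hp' : p ≠ ∞) (s : ℝ) {η : ℝ≥0∞} (hη : η ≠ 0) (hη' : η ≠ ∞) :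
    ∃ b : ℝ≥0∞, b ≠ ∞ ∧ ∀ t,
      (M.tsLaw θs t).toOuterMeasure {h | b ≤ (M.misfitCount θs ε p s h : ℝ≥0∞)} ≤ η := by
  classical
  obtain ⟨d, hd0, hd⟩ : ∃ d : ℝ, 0 < d ∧
      ∀ θ, M.div θs θ (M.opt θs) ≠ 0 → d ≤ M.div θs θ (M.opt θs) := by
    -- Taking `d` small instead of as a minimum covers the case without misfits.
    have h : ∀ᶠ d : ℝ in nhdsWithin 0 (Set.Ioi 0),
        ∀ θ, M.div θs θ (M.opt θs) ≠ 0 → d ≤ M.div θs θ (M.opt θs) := by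
      refine Filter.eventually_all.2 fun θ => ?_
      by_cases h0 : M.div θs θ (M.opt θs) = 0
      · simp [h0]
      · have hpos := (M.div_nonneg θs θ (M.opt θs)).lt_of_ne' h0
        filter_upwards [nhdsWithin_le_nhds (Iic_mem_nhds hpos)] with d hd _
        exact hd
    obtain ⟨d, hd, hd0⟩ := (h.and self_mem_nhdsWithin).exists
    exact ⟨d, hd0, hd⟩
  let c : ℝ := (1 - ε) * d
  have hc0 : 0 < c := mul_pos (sub_pos.2 hε) hd0
  let r : ℝ≥0∞ := ENNReal.ofReal (Real.exp (-c))
  have hr : r < 1 := by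
    rw [ENNReal.ofReal_lt_one]
    exact Real.exp_lt_one_iff.2 (neg_neg_of_pos hc0)
  let K : ℝ≥0∞ := Fintype.card Θ * ((M.prior θs)⁻¹ * ENNReal.ofReal (Real.exp s))
  have hK : K ≠ ∞ := ENNReal.mul_ne_top (ENNReal.natCast_ne_top _)
    (ENNReal.mul_ne_top (ENNReal.inv_ne_top.2 hprior) ENNReal.ofReal_ne_top)
  let q : ℝ≥0∞ := p * (1 - r)
  have hq : q ≠ 0 := mul_ne_zero hp (tsub_pos_of_lt hr).ne'
  have hq' : q ≠ ∞ := ENNReal.mul_ne_top hp' (ENNReal.sub_ne_top ENNReal.one_ne_top)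
  let κ : ℝ≥0∞ := K / q
  let N : List (Θ × Y) → ℕ := fun h => M.playCount h (M.opt θs)
  let U : List (Θ × Y) → ℝ≥0∞ := fun h =>
    if M.Good θs ε p s h then ENNReal.ofReal (Real.exp (-c * N h)) else 0
  have hU : ∀ h, M.step θs U h + q * U h ≤ U h := by
    intro h
    by_cases hg : M.Good θs ε p s h
    · have hUh : U h = ENNReal.ofReal (Real.exp (-c * N h)) := if_pos hg
      let g : Θ → ℝ≥0∞ := fun ϑ => U h * if ϑ = θs then r else 1
      have hle : ∀ e, U (e :: h) ≤ g e.1 := by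
        intro e
        have h1 : U (e :: h) ≤ ENNReal.ofReal (Real.exp (-c * N (e :: h))) := by
          simp only [U]
          split_ifs
          exacts [le_rfl, zero_le]
        refine h1.trans ?_
        simp only [g, hUh]
        by_cases he : e.1 = θs
        · have : -c * (N (e :: h) : ℝ) = -c * N h + -c := by
            simp only [N, playCount_cons, he, if_true]
            push_cast
            ring
          rw [this, Real.exp_add, ENNReal.ofReal_mul (Real.exp_pos _).le, if_pos he]
        · rw [if_neg he, mul_one]
          refine ENNReal.ofReal_le_ofReal (Real.exp_le_exp.2 ?_)
          have : (N h : ℝ) ≤ N (e :: h) := by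
            simp only [N, playCount_cons]
            push_cast
            split_ifs <;> simp
          nlinarith
      have hstep : M.step θs U h ≤ U h * ∑ ϑ, M.posterior h ϑ * if ϑ = θs then r else 1 := by
        refine (M.step_mono θs (g := fun h' => g (h'.head?.elim θs Prod.fst)) h hle).trans_eq ?_
        rw [M.step_of_sample θs (g := g) fun e => rfl, Finset.mul_sum]
        exact Finset.sum_congr rfl fun ϑ _ => by simp only [g]; ring
      have hsum : ∑ ϑ, M.posterior h ϑ * (if ϑ = θs then r else 1) + q ≤ 1 := by
        calc ∑ ϑ, M.posterior h ϑ * (if ϑ = θs then r else 1) + q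
            ≤ ∑ ϑ, M.posterior h ϑ * (if ϑ = θs then r else 1) +
              M.posterior h θs * (1 - r) := by
              exact add_le_add_right (mul_le_mul_left hg.self.1 _) _
          _ = ∑ ϑ, (M.posterior h ϑ * (if ϑ = θs then r else 1) +
              if ϑ = θs then M.posterior h ϑ * (1 - r) else 0) := by
              rw [Finset.sum_add_distrib, Finset.sum_ite_eq' Finset.univ θs,
                if_pos (Finset.mem_univ _)]
          _ = ∑ ϑ, M.posterior h ϑ := by
              refine Finset.sum_congr rfl fun ϑ _ => ?_
              split_ifs
              · rw [← mul_add, add_tsub_cancel_of_le hr.le, mul_one]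
              · simp
          _ = 1 := M.sum_posterior h
      calc M.step θs U h + q * U h
          ≤ U h * ∑ ϑ, M.posterior h ϑ * (if ϑ = θs then r else 1) + q * U h := by gcongr
        _ = U h * (∑ ϑ, M.posterior h ϑ * (if ϑ = θs then r else 1) + q) := by ring
        _ ≤ U h * 1 := by gcongr
        _ = U h := mul_one _
    · have h0 : ∀ e, U (e :: h) = 0 := fun e => if_neg fun he => hg he.tail
      have hUh : U h = 0 := if_neg hg
      rw [M.step_of_const θs h0, hUh]
      simp
  let F : List (Θ × Y) → ℝ≥0∞ := fun h => M.misfitCount θs ε p s h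
  have hF : ∀ h, M.step θs F h ≤ F h + K * U h := by
    intro h
    let g : Θ → ℝ≥0∞ := fun ϑ =>
      if M.Good θs ε p s h ∧ M.div θs ϑ (M.opt θs) ≠ 0 then 1 else 0
    have heq : ∀ e, F (e :: h) = F h + g e.1 := by
      intro e
      simp only [F, g, misfitCount]
      push_cast
      rfl
    have hg : M.step θs (fun h' => g (h'.head?.elim θs Prod.fst)) h ≤ K * U h := by
      rw [M.step_of_sample θs (g := g) fun e => rfl]
      have hKU : K * U h = Fintype.card Θ *
          ((M.prior θs)⁻¹ * ENNReal.ofReal (Real.exp s) * U h) := by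
        simp only [K]
        ring
      rw [hKU, ← nsmul_eq_mul]
      refine Finset.sum_le_card_nsmul _ _ _ fun ϑ _ => ?_
      by_cases hϑ : M.Good θs ε p s h ∧ M.div θs ϑ (M.opt θs) ≠ 0
      · have hUh : U h = ENNReal.ofReal (Real.exp (-c * N h)) := if_pos hϑ.1
        simp only [g, if_pos hϑ, mul_one]
        refine (posterior_le_of_score_le hlik hprior (hϑ.1.self.2 ϑ)).trans ?_
        rw [hUh, mul_assoc, ← ENNReal.ofReal_mul (Real.exp_pos _).le, ← Real.exp_add]
        refine mul_le_mul_right (ENNReal.ofReal_le_ofReal (Real.exp_le_exp.2 ?_)) _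
        have h1 : (N h : ℝ) * d ≤ M.totalDiv θs ϑ h :=
          (mul_le_mul_of_nonneg_left (hd ϑ hϑ.2) (Nat.cast_nonneg _)).trans
            (M.playCount_mul_le_totalDiv θs ϑ h (M.opt θs))
        have h2 := mul_le_mul_of_nonneg_left h1 (sub_nonneg.2 hε.le)
        have h3 : -c * (N h : ℝ) = - ((1 - ε) * (N h * d)) := by simp only [c]; ring
        linarith
      · simp [g, if_neg hϑ]
    calc M.step θs F h
        ≤ M.step θs (fun h' => F h'.tail + g (h'.head?.elim θs Prod.fst)) h :=
          M.step_mono θs h fun e => (heq e).le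
      _ = F h + M.step θs (fun h' => g (h'.head?.elim θs Prod.fst)) h := by
          rw [M.step_add θs (fun h' => F h'.tail), M.step_of_const θs (c := F h) (fun e => rfl)]
      _ ≤ _ := by gcongr
  have hΦ : ∀ h, M.step θs (fun h => F h + κ * U h) h ≤ F h + κ * U h := by
    intro h
    have hκ : M.step θs (fun h => κ * U h) h = κ * M.step θs U h := by
      simp only [step, Finset.mul_sum]
      exact Finset.sum_congr rfl fun _ _ => Finset.sum_congr rfl fun _ _ => by ring
    calc M.step θs (fun h => F h + κ * U h) h = M.step θs F h + κ * M.step θs U h := by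
          rw [M.step_add θs F, hκ]
      _ ≤ F h + K * U h + κ * M.step θs U h := by gcongr; exact hF h
      _ = F h + κ * (M.step θs U h + q * U h) := by
          rw [show K = κ * q from (ENNReal.div_mul_cancel hq hq').symm]
          ring
      _ ≤ F h + κ * U h := by gcongr; exact hU h
  have hκ' : κ ≠ ∞ := ENNReal.div_ne_top hK hq
  -- The `+ 1` makes the numerator evidently nonzero.
  refine ⟨(κ + 1) / η, ENNReal.div_ne_top (ENNReal.add_ne_top.2 ⟨hκ', ENNReal.one_ne_top⟩) hη,
    fun t => ?_⟩
  have h1 := M.mul_toOuterMeasure_le_expect θs t F ((κ + 1) / η)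
  have h2 : M.expect θs t F ≤ κ + 1 := by
    refine (M.expect_mono θs t fun h => le_self_add).trans
      ((M.expect_le_of_step_le θs hΦ t).trans ?_)
    have hU1 : U [] ≤ 1 := by
      simp only [U, N, playCount]
      split_ifs <;> simp
    have hF0 : F [] = 0 := by simp [F, misfitCount]
    rw [hF0, zero_add]
    exact (mul_le_of_le_one_right' hU1).trans le_self_add
  exact ENNReal.le_of_div_mul_le (by simp) (ENNReal.add_ne_top.2 ⟨hκ', ENNReal.one_ne_top⟩) hη hη'
    (h1.trans h2)

end Misfits

/-! ### Splitting suboptimal plays into matches and misfits. -/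

section RegretDecomposition

variable [DecidableEq A] (M : BanditModel A Θ Y) (θs : Θ)

open Classical in
/-- The number of plays of each suboptimal action through parameters that agree with `θs` on the
optimal action. -/
noncomputable def matchCount : List (Θ × Y) → A → ℕ
  | [] => 0
  | e :: h => matchCount h +
      if M.opt e.1 ≠ M.opt θs ∧ M.div θs e.1 (M.opt θs) = 0 then Pi.single (M.opt e.1) 1 else 0

variable {M θs}

theorem matchCount_le_playCount (h : List (Θ × Y)) : M.matchCount θs h ≤ M.playCount h := by
  induction h with
  | nil => exact fun _ => le_rfl
  | cons e h ih =>
    intro a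
    rw [playCount_cons, matchCount, Pi.add_apply]
    refine add_le_add (ih a) ?_
    split_ifs with h1 h2 h2
    · subst h2
      simp
    · rw [Pi.single_eq_of_ne (Ne.symm h2)]
    · exact Nat.zero_le _
    · exact le_rfl

variable [Fintype A]

/-- Without late plays, each counted parameter was drawn while its total divergence was below `L`.
The matched counts are at most the play counts, so the action was active for them too. -/
theorem reachable_matchCount {ε : ℝ} {p : ℝ≥0∞} {s L : ℝ} {h : List (Θ × Y)}
    (hg : M.Good θs ε p s h) (hlate : ¬ M.LatePlay θs ε p s L h) :
    M.Reachable θs L (M.matchCount θs h) := by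
  induction h with
  | nil => exact Reachable.zero
  | cons e h ih =>
    rw [LatePlay, not_or] at hlate
    have hr := ih hg.tail hlate.1
    rw [matchCount]
    split_ifs with he
    · refine hr.play ⟨he.1, e.1, ⟨rfl, he.2⟩, ?_⟩
      refine (weighted_div_mono (matchCount_le_playCount h) e.1).trans_lt ?_
      rw [← totalDiv_eq_sum]
      exact not_le.1 fun hle => hlate.2 ⟨hg.tail, hle⟩
    · simpa using hr

theorem sum_playCount_le {ε : ℝ} {p : ℝ≥0∞} {s : ℝ} {h : List (Θ × Y)}
    (hg : M.Good θs ε p s h) :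
    ∑ a ∈ Finset.univ.erase (M.opt θs), M.playCount h a ≤
      M.misfitCount θs ε p s h + ∑ a ∈ Finset.univ.erase (M.opt θs), M.matchCount θs h a := by
  induction h with
  | nil => simp [playCount]
  | cons e h ih =>
    have h1 := ih hg.tail
    simp only [playCount_cons, matchCount, misfitCount, Pi.add_apply, Finset.sum_add_distrib,
      Finset.sum_ite_eq, Finset.mem_erase, Finset.mem_univ, and_true]
    by_cases ho : M.opt e.1 = M.opt θs
    · simp only [ho, ne_eq, not_true_eq_false, if_false, false_and]
      simp
      omega
    · by_cases hD : M.div θs e.1 (M.opt θs) = 0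
      · have hsingle : ∑ a ∈ Finset.univ.erase (M.opt θs),
            (Pi.single (M.opt e.1) 1 : A → ℕ) a = 1 := by
          rw [Finset.sum_pi_single']
          simp [ho]
        simp only [ho, hD, ne_eq, not_false_eq_true, not_true_eq_false, and_false, and_true,
          if_true, if_false, hsingle]
        omega
      · simp only [ho, hD, ne_eq, not_false_eq_true, hg.tail, and_false, and_true, if_true,
          if_false, Pi.zero_apply, Finset.sum_const_zero]
        omega

end RegretDecomposition

/-- The threshold is chosen so that `1 - ε` cancels: `t * exp (s - (1 + ε) * log t) = exp s * t ^
(-ε)`. -/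
theorem eventually_latePlay_bound_le {c η : ℝ≥0∞} (hc : c ≠ ∞) (hη : η ≠ 0) {ε : ℝ} (hε : 0 < ε)
    (hε' : ε < 1) (s : ℝ) : ∀ᶠ t : ℕ in Filter.atTop, (t : ℝ≥0∞) * (c *
      ENNReal.ofReal (Real.exp (s - (1 - ε) * ((1 + ε) / (1 - ε) * Real.log t)))) ≤ η := by
  have hlim : Filter.Tendsto (fun t : ℕ => c * ENNReal.ofReal (Real.exp s * (t : ℝ) ^ (-ε)))
      Filter.atTop (nhds 0) := by
    have h1 : Filter.Tendsto (fun t : ℕ => Real.exp s * (t : ℝ) ^ (-ε)) Filter.atTop (nhds 0) := by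
      simpa using ((tendsto_rpow_neg_atTop hε).comp tendsto_natCast_atTop_atTop).const_mul
        (Real.exp s)
    have h2 := ENNReal.tendsto_ofReal h1
    rw [ENNReal.ofReal_zero] at h2
    simpa using ENNReal.Tendsto.const_mul h2 (Or.inr hc)
  filter_upwards [hlim.eventually (ge_mem_nhds (pos_iff_ne_zero.2 hη)),
    Filter.eventually_gt_atTop 0] with t ht ht0
  refine le_of_eq_of_le ?_ ht
  have ht0' : (0 : ℝ) < t := Nat.cast_pos.2 ht0
  have hne : (1 - ε) ≠ 0 := (sub_pos.2 hε').ne'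
  have hexp : (t : ℝ) * Real.exp (s - (1 - ε) * ((1 + ε) / (1 - ε) * Real.log t)) =
      Real.exp s * (t : ℝ) ^ (-ε) := by
    rw [Real.rpow_def_of_pos ht0', ← Real.exp_add]
    nth_rewrite 1 [← Real.exp_log ht0']
    rw [← Real.exp_add]
    congr 1
    field_simp
    ring
  rw [← hexp, ENNReal.ofReal_mul ht0'.le, ENNReal.ofReal_natCast]
  ring

/-! ### The regret bound. -/

theorem exists_regret_bound [Fintype A] [DecidableEq A] [Fintype Θ] (M : BanditModel A Θ Y)
    (hlik : ∀ a θ y, 0 < (M.lik a θ y).toReal) {δ ε : ℝ} (hδ : 0 < δ)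
    (hε : ε ∈ Set.Ioo (0 : ℝ) 1) {θs : Θ} (hprior : M.prior θs ≠ 0)
    (hopt : ∀ a, a ≠ M.opt θs → M.meanReward a θs < M.meanReward (M.opt θs) θs) :
    ∃ B : ℝ, ∃ T₀ : ℕ, ∀ T : ℕ, T₀ ≤ T →
      ∃ C : ℕ, IsGreatest (M.pathValues θs ((1 + ε) / (1 - ε) * Real.log T)) C ∧
        ENNReal.ofReal (1 - δ) ≤ (M.tsLaw θs T).toOuterMeasure
          {h | ((∑ a ∈ Finset.univ.erase (M.opt θs), M.playCount h a : ℕ) : ℝ) ≤ B + C} := by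
  have hsep := M.separated_of_unique_opt θs hlik hopt
  -- Two shares for bad histories, one for late plays, one for misfits.
  let η : ℝ≥0∞ := ENNReal.ofReal (δ / 4)
  have hη : η ≠ 0 := (ENNReal.ofReal_pos.2 (by linarith)).ne'
  have hη' : η ≠ ∞ := ENNReal.ofReal_ne_top
  obtain ⟨p, hp, hp', s, hgood⟩ := exists_toOuterMeasure_not_good_le hlik hprior hε.1 hη hη'
  obtain ⟨b, hb, hmis⟩ :=
    exists_toOuterMeasure_misfitCount_le hlik hprior hε.2 hp hp' s hη hη'
  have hcne : (Fintype.card Θ : ℝ≥0∞) * (M.prior θs)⁻¹ ≠ ∞ :=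
    ENNReal.mul_ne_top (ENNReal.natCast_ne_top _) (ENNReal.inv_ne_top.2 hprior)
  obtain ⟨T₀, hT₀⟩ := Filter.eventually_atTop.1
    -- `T ≥ 2` ensures `log T > 0`, hence `L > 0`.
    ((eventually_latePlay_bound_le hcne hη hε.1 hε.2 s).and (Filter.eventually_ge_atTop 2))
  refine ⟨b.toReal, T₀, fun T hT => ?_⟩
  obtain ⟨hlate, hT2⟩ := hT₀ T hT
  set L : ℝ := (1 + ε) / (1 - ε) * Real.log T with hLdef
  have hL : 0 < L := mul_pos (div_pos (by linarith [hε.1]) (sub_pos.2 hε.2))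
    (Real.log_pos (by exact_mod_cast hT2))
  obtain ⟨C, hC⟩ := exists_isGreatest_pathValues hsep hL
  refine ⟨C, hC, ?_⟩
  have hlate' : (M.tsLaw θs T).toOuterMeasure {h | M.LatePlay θs ε p s L h} ≤ η :=
    (toOuterMeasure_latePlay_le hlik hprior hε.2 p s L T).trans (by rwa [← mul_assoc (Fintype.card Θ : ℝ≥0∞)])
  let S : Set (List (Θ × Y)) :=
    {h | ((∑ a ∈ Finset.univ.erase (M.opt θs), M.playCount h a : ℕ) : ℝ) ≤ b.toReal + C}
  have hcover : Set.univ ⊆ S ∪ ({h | ¬ M.Good θs ε p s h} ∪ ({h | M.LatePlay θs ε p s L h} ∪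
      {h | b ≤ (M.misfitCount θs ε p s h : ℝ≥0∞)})) := by
    intro h _
    by_cases hg : M.Good θs ε p s h
    swap
    · exact Or.inr (Or.inl hg)
    by_cases hl : M.LatePlay θs ε p s L h
    · exact Or.inr (Or.inr (Or.inl hl))
    by_cases hm : b ≤ (M.misfitCount θs ε p s h : ℝ≥0∞)
    · exact Or.inr (Or.inr (Or.inr hm))
    refine Or.inl ?_
    obtain ⟨v, hv, hle⟩ := (reachable_matchCount hg hl).exists_pathValue_ge hsep hL
    have h1 := (sum_playCount_le hg).trans (add_le_add_right (hle.trans (hC.2 hv)) _)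
    have h2 : (M.misfitCount θs ε p s h : ℝ) ≤ b.toReal := by
      have := ENNReal.toReal_mono hb (not_le.1 hm).le
      rwa [ENNReal.toReal_natCast] at this
    have h3 : ((∑ a ∈ Finset.univ.erase (M.opt θs), M.playCount h a : ℕ) : ℝ) ≤
        M.misfitCount θs ε p s h + C := by exact_mod_cast h1
    exact h3.trans (by linarith)
  have huniv : (M.tsLaw θs T).toOuterMeasure Set.univ = 1 :=
    (PMF.toOuterMeasure_apply_eq_one_iff _ _).2 (Set.subset_univ _)
  have htotal : 1 ≤ (M.tsLaw θs T).toOuterMeasure S + ENNReal.ofReal δ := by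
    calc 1 = (M.tsLaw θs T).toOuterMeasure Set.univ := huniv.symm
      _ ≤ (M.tsLaw θs T).toOuterMeasure S + ((η + η) + (η + η)) := by
        refine (MeasureTheory.measure_mono hcover).trans ?_
        refine (MeasureTheory.measure_union_le _ _).trans (add_le_add_right ?_ _)
        refine (MeasureTheory.measure_union_le _ _).trans (add_le_add (hgood T) ?_)
        exact (MeasureTheory.measure_union_le _ _).trans (add_le_add hlate' (hmis T))
      _ = _ := by
        have h4 : (0 : ℝ) ≤ δ / 4 := by linarith
        simp only [η]
        rw [← ENNReal.ofReal_add h4 h4, ← ENNReal.ofReal_add (by linarith) (by linarith)]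
        congr 2
        ring
  rw [ENNReal.ofReal_sub _ hδ.le, ENNReal.ofReal_one]
  exact tsub_le_iff_right.2 htotal

end BanditModel

theorem theorem1 {A Θ Y : Type*} [Fintype A] [DecidableEq A] [Fintype Θ] [Fintype Y]
    (M : BanditModel A Θ Y)
    (Γ : ℝ) (hΓ : Γ ∈ Set.Ioo (0 : ℝ) (1 / 2))
    (hlik : ∀ a θ y, Γ ≤ (M.lik a θ y).toReal ∧ (M.lik a θ y).toReal ≤ 1 - Γ)
    (δ ε : ℝ) (hδ : δ ∈ Set.Ioo (0 : ℝ) 1) (hε : ε ∈ Set.Ioo (0 : ℝ) 1) :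
    ∃ B : ℝ, ∀ θs : Θ, M.prior θs ≠ 0 →
      (∀ a, a ≠ M.opt θs → M.meanReward a θs < M.meanReward (M.opt θs) θs) →
      ∃ T₀ : ℕ, ∀ T : ℕ, T₀ ≤ T →
        ∃ C : ℕ, IsGreatest (M.pathValues θs ((1 + ε) / (1 - ε) * Real.log T)) C ∧
          ENNReal.ofReal (1 - δ) ≤ (M.tsLaw θs T).toOuterMeasure
            {h | ((∑ a ∈ Finset.univ.erase (M.opt θs), M.playCount h a : ℕ) : ℝ) ≤ B + C} := by
  have hpos : ∀ a θ y, 0 < (M.lik a θ y).toReal := fun a θ y => hΓ.1.trans_le (hlik a θ y).1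
  have hbound : ∀ θs : Θ, ∃ B : ℝ, M.prior θs ≠ 0 →
      (∀ a, a ≠ M.opt θs → M.meanReward a θs < M.meanReward (M.opt θs) θs) →
      ∃ T₀ : ℕ, ∀ T : ℕ, T₀ ≤ T →
        ∃ C : ℕ, IsGreatest (M.pathValues θs ((1 + ε) / (1 - ε) * Real.log T)) C ∧
          ENNReal.ofReal (1 - δ) ≤ (M.tsLaw θs T).toOuterMeasure
            {h | ((∑ a ∈ Finset.univ.erase (M.opt θs), M.playCount h a : ℕ) : ℝ) ≤ B + C} := by
    intro θs
    by_cases h : M.prior θs ≠ 0 ∧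
        ∀ a, a ≠ M.opt θs → M.meanReward a θs < M.meanReward (M.opt θs) θs
    · obtain ⟨B, hB⟩ := M.exists_regret_bound hpos hδ.1 hε h.1 h.2
      exact ⟨B, fun _ _ => hB⟩
    · exact ⟨0, fun h1 h2 => absurd ⟨h1, h2⟩ h⟩
  choose B hB using hbound
  -- As `Θ` is finite, one constant serves every true parameter.
  obtain ⟨B', hB'⟩ := (Set.finite_range B).bddAbove
  refine ⟨B', fun θs hprior hopt => ?_⟩
  obtain ⟨T₀, hT₀⟩ := hB θs hprior hopt
  refine ⟨T₀, fun T hT => ?_⟩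
  obtain ⟨C, hC, hprob⟩ := hT₀ T hT
  refine ⟨C, hC, hprob.trans (MeasureTheory.measure_mono fun h hh => ?_)⟩
  exact le_trans hh (add_le_add_left (hB' (Set.mem_range_self θs)) _)
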